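/- **Setting.** Let $Q,K\in\mathbb R^{n\times d_{kq}}$, $V\in\mathbb R^{n\times d_v}$, $u\in\mathbb R^{d_v}$, and let $f_1,\dots,f_n:\mathbb R\to\mathbb R$ be non-decreasing. For $S\subseteq[n]$ let $X_S\in\{0,1\}^{n\times n}$ be the diagonal matrix with $(X_S)_{ii}=1$ iff $i\in S$, and let $$\mathrm{SA}(X_S)=\mathrm{softmax}\big((X_SQ)(X_SK)^\top\big)\,X_SV .$$ Problem (Main) with budget $k$ is to maximize $\sum_{i\in S} f_i\big(\mathrm{SA}(X_S)_i^\top u\big)$ over $S\subseteq[n]$, $|S|\le k$; its optimal value is denoted $\mathrm{OPT}$. The row-wise softmax is normalized either over all $n$ columns (so that each $j\notin S$ contributes $\exp(0)=1$), or over the columns $j\in S$ only (so that row $i\in S$ is a weighted average of the value vectors of $S$). The result below holds for each of these two conventions. Graphs are simple with vertex set $\{1,\dots,n-1\}$, $n\ge 2$; vertex $v$ corresponds to item $v$, and item $n$ is extra. **(a)** *If $d_{kq}=n$ and $k\ge4$, Problem (Main) subsumes the $(k-1)$-Clique problem on graphs with $n-1$ vertices.* Precisely: there are a number $d_v$ and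 five fixed formulas, independent of $n$, $k$ and the graph and built from rational constants by $+$, $\times$ and case distinctions "if $s\le t$ then … else …", such that for all $n\ge2$, $k\ge4$ and every graph $G$ on $n-1$ vertices the following holds. There is an instance of Problem (Main) with $n$ items, budget $k$ and $d_{kq}=n$ in which each entry $Q_{ij}$ and each entry $K_{ij}$ is the value of its formula at $n,k,i,j$ and the adjacency bit of $(i,j)$ in $G$ (the bit is $0$ if $i=n$ or $j=n$), while $V_{ij}$, $u_j$ and $f_i(x)$ are the values of their formulas at $(n,k,i,j)$, $(n,k,j)$ and $(n,k,i,x)$ respectively and do not depend on $G$. (So the instance is written down in $O(n^2)$ arithmetic operations.) This instance has $\mathrm{OPT}>0$. If $G$ has a clique of size $k-1$, then $\mathrm{OPT}=k-1$ and for every optimal $S$ the set $S\setminus\{n\}$ is a clique of size $k-1$ in $G$. If $G$ has no such clique, then $\mathrm{OPT}<k-1$. **(b)** For every real $M\ge3$ there is $c=c(M)>0$ such that for all $n$, $d_{kq}$, $k$ with $\exp(c\,d_{kq})\le n-1$ and $k\ge M+1$, *Problem (Main) subsumes finding a largest clique in a graph with $n-1$ vertices made of $\exp(c\,d_{kq})$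 disjoint cliques of sizes between $k-M$ and $k-1$.* Precisely: for every integer $0\le\ell\le\exp(c\,d_{kq})$ there are $d_v$, $V$, $u$, non-decreasing $f_1,\dots,f_n$, and two tables assigning a query vector and a key vector in $\mathbb R^{d_{kq}}$ to each label in $\{1,\dots,\ell\}$ and to the extra item, all chosen before the graph is given, such that the following holds. Let $G$ be any graph on $n-1$ vertices that is the disjoint union of $\ell$ cliques labelled $1,\dots,\ell$ (two distinct vertices are adjacent iff their labels agree), each of size at least $k-M$ and at most $k-1$. Consider the instance of Problem (Main) with this $V,u,f_1,\dots,f_n$ and budget $k$ in which the query and key vectors of each vertex item are looked up at the label of its clique, and those of item $n$ are the ones assigned to the extra item. It has $\mathrm{OPT}>0$, and for every optimal $S$ the set $S\setminus\{n\}$ is a largest clique of $G$ and $\mathrm{OPT}=|S\setminus\{n\}|$. -/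

import Mathlib

open scoped Matrix

noncomputable section

namespace SimpleTransformer

/-! ## Simple transformers and Problem (Main) -/

/-- Row-wise softmax with the normalisation taken over the columns in `J` (weight `0` outside `J`).
For `J = univ` this is the usual softmax `exp (A i j) / ∑ l, exp (A i l)`. -/
def softmaxOn {n : ℕ} (J : Finset (Fin n)) (A : Matrix (Fin n) (Fin n) ℝ) :
    Matrix (Fin n) (Fin n) ℝ :=
  Matrix.of fun i j => if j ∈ J then Real.exp (A i j) / ∑ l ∈ J, Real.exp (A i l) else 0

/-- The set-membership matrix `X_S`. -/
def membership {n : ℕ} (S : Finset (Fin n)) : Matrix (Fin n) (Fin n) ℝ :=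
  Matrix.diagonal fun i => if i ∈ S then 1 else 0

/-- The two conventions for evaluating a self-attention layer on a set `S` of items.
`zeroed`: the softmax of `(X_S Q)(X_S K)ᵀ` runs over all `n` columns, so that every `j ∉ S` still
contributes `exp 0 = 1` to the normalisation.
`restricted`: the softmax runs over the columns in `S` only, so that the output is a weighted
average of the value vectors of the items in `S`. -/
inductive Masking
  | zeroed
  | restricted

/-- The columns over which the softmax is normalised. -/
def Masking.columns (mode : Masking) {n : ℕ} (S : Finset (Fin n)) : Finset (Fin n) :=
  match mode with
  | .zeroed => Finset.univ
  | .restricted => S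

/-- The self-attention layer evaluated at the set `S`:
`softmax ((X_S Q) (X_S K)ᵀ) (X_S V)`. -/
def selfAttention (mode : Masking) {n d dv : ℕ} (Q K : Matrix (Fin n) (Fin d) ℝ)
    (V : Matrix (Fin n) (Fin dv) ℝ) (S : Finset (Fin n)) : Matrix (Fin n) (Fin dv) ℝ :=
  softmaxOn (mode.columns S) ((membership S * Q) * (membership S * K)ᵀ) * (membership S * V)

/-- The data of Problem (Main), apart from the budget `k`: query, key and value matrices, a user
vector, and non-decreasing reward functions. -/
structure Instance (n d dv : ℕ) where
  Q : Matrix (Fin n) (Fin d) ℝ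
  K : Matrix (Fin n) (Fin d) ℝ
  V : Matrix (Fin n) (Fin dv) ℝ
  u : Fin dv → ℝ
  f : Fin n → ℝ → ℝ
  monotone_f : ∀ i, Monotone (f i)

/-- The objective `∑ i ∈ S, f i (SA(X_S)_i · u)` of Problem (Main). -/
def Instance.objective (mode : Masking) {n d dv : ℕ} (T : Instance n d dv) (S : Finset (Fin n)) :
    ℝ :=
  ∑ i ∈ S, T.f i (selfAttention mode T.Q T.K T.V S i ⬝ᵥ T.u)

/-- `S` is an optimal solution of Problem (Main) with budget `k`. -/
def Instance.IsOptimal (mode : Masking) {n d dv : ℕ} (T : Instance n d dv) (k : ℕ)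
    (S : Finset (Fin n)) : Prop :=
  S.card ≤ k ∧ ∀ S' : Finset (Fin n), S'.card ≤ k → T.objective mode S' ≤ T.objective mode S

/-- The standing assumption `OPT > 0`. -/
def Instance.OptPos (mode : Masking) {n d dv : ℕ} (T : Instance n d dv) (k : ℕ) : Prop :=
  ∃ S : Finset (Fin n), S.card ≤ k ∧ 0 < T.objective mode S

/-! ## Reading a vertex set off a solution

The graphs have vertices `Fin m`; the items are `Fin (m + 1)`, i.e. `n = m + 1`. The vertex `v` is
the item `v.castSucc`, and `Fin.last m` is the one additional item. -/

/-- The vertices among the items of `S` (i.e. `S` without the additional item). -/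
def vertices {m : ℕ} (S : Finset (Fin (m + 1))) : Finset (Fin m) :=
  Finset.univ.filter fun v => v.castSucc ∈ S

/-- Every optimal solution of Problem (Main) on `T` solves the `(k-1)`-clique problem on `G`: if
there is a `(k-1)`-clique then the optimal value is `k-1` and the vertices selected form such a
clique; otherwise the optimal value is less than `k-1`. -/
def SolvesClique (mode : Masking) {m d dv : ℕ} (T : Instance (m + 1) d dv) (k : ℕ)
    (G : SimpleGraph (Fin m)) : Prop :=
  ∀ S, T.IsOptimal mode k S →
    ((∃ C, G.IsNClique (k - 1) C) →
      T.objective mode S = (k : ℝ) - 1 ∧ G.IsNClique (k - 1) (vertices S)) ∧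
    ((¬ ∃ C, G.IsNClique (k - 1) C) → T.objective mode S < (k : ℝ) - 1)

/-- Every optimal solution of Problem (Main) on `T` yields a largest clique of `G`, and the optimal
value is the size of that clique. -/
def SolvesMaxClique (mode : Masking) {m d dv : ℕ} (T : Instance (m + 1) d dv) (k : ℕ)
    (G : SimpleGraph (Fin m)) : Prop :=
  ∀ S, T.IsOptimal mode k S →
    (∀ C : Finset (Fin m), G.IsClique (C : Set (Fin m)) → C.card ≤ (vertices S).card) ∧
    G.IsClique (vertices S : Set (Fin m)) ∧
    T.objective mode S = ((vertices S).card : ℝ)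

/-! ## Uniform, constant-time reductions

A reduction to Problem (Main) has to be effective: an arbitrary map from graphs to instances could
hide the answer in the instance. Here every number of the instance is the value of one *fixed*
arithmetic formula, the same for all sizes, budgets and graphs, which sees one adjacency bit.
The whole instance with `d_kq = n` is thus written down in `O(n ^ 2)` arithmetic operations. -/

/-- The quantities which a formula may use: the number of items `n`, the budget `k`, a row index
`i` and a column index `j` (counted from `1`), one adjacency bit, and a real argument `x`. -/
inductive Var
  | n
  | k
  | i
  | j
  | bit
  | x

/-- Loop-free arithmetic formulas: rational constants, sums, products and case distinctions. -/
inductive Formula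
  | var (v : Var)
  | const (q : ℚ)
  | add (s t : Formula)
  | mul (s t : Formula)
  | ifLe (a b s t : Formula)

/-- The value of a formula; `ifLe a b s t` is `s` if `a ≤ b`, and `t` otherwise. -/
def Formula.eval (env : Var → ℝ) : Formula → ℝ
  | .var v => env v
  | .const q => (q : ℝ)
  | .add s t => s.eval env + t.eval env
  | .mul s t => s.eval env * t.eval env
  | .ifLe a b s t => if a.eval env ≤ b.eval env then s.eval env else t.eval env

/-- The assignment of values to the variables. -/
def env (n k i j bit x : ℝ) : Var → ℝ
  | .n => n
  | .k => k
  | .i => i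
  | .j => j
  | .bit => bit
  | .x => x

open Classical in
/-- The adjacency bit of two items: `1` if both are vertices and they are adjacent, else `0`. -/
def adjBit {m : ℕ} (G : SimpleGraph (Fin m)) (i j : Fin (m + 1)) : ℝ :=
  if ∃ v w : Fin m, v.castSucc = i ∧ w.castSucc = j ∧ G.Adj v w then 1 else 0

/-- Five formulas, one for the entries of each part of an instance. -/
structure Program where
  Q : Formula
  K : Formula
  V : Formula
  u : Formula
  f : Formula

/-- `T` is what the program `P` writes down for the graph `G` and the budget `k`, with `d_kq = n`.
An entry of `Q` or `K` is computed from `n`, `k`, its position, and the adjacency bit at that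
position; `V`, `u` and the reward functions do not depend on the graph. -/
structure Program.Outputs (P : Program) {m dv : ℕ} (k : ℕ) (G : SimpleGraph (Fin m))
    (T : Instance (m + 1) (m + 1) dv) : Prop where
  Q : ∀ i j, T.Q i j =
    P.Q.eval (env ((m : ℝ) + 1) k ((i : ℕ) + 1) ((j : ℕ) + 1) (adjBit G i j) 0)
  K : ∀ i j, T.K i j =
    P.K.eval (env ((m : ℝ) + 1) k ((i : ℕ) + 1) ((j : ℕ) + 1) (adjBit G i j) 0)
  V : ∀ i j, T.V i j = P.V.eval (env ((m : ℝ) + 1) k ((i : ℕ) + 1) ((j : ℕ) + 1) 0 0)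
  u : ∀ j, T.u j = P.u.eval (env ((m : ℝ) + 1) k 0 ((j : ℕ) + 1) 0 0)
  f : ∀ i x, T.f i x = P.f.eval (env ((m : ℝ) + 1) k ((i : ℕ) + 1) 0 0 x)

/-! ## Graphs made of disjoint cliques -/

/-- `G` is the disjoint union of the `l` cliques `lab ⁻¹ {a}`, each of which has size at least
`k - M` and at most `k - 1`. -/
structure IsDisjointCliques {m l : ℕ} (G : SimpleGraph (Fin m)) (lab : Fin m → Fin l) (k : ℕ)
    (M : ℝ) : Prop where
  adj_iff : ∀ v w, G.Adj v w ↔ v ≠ w ∧ lab v = lab w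
  le_card : ∀ a, (k : ℝ) - M ≤ ((Finset.univ.filter fun v => lab v = a).card : ℝ)
  card_le : ∀ a, ((Finset.univ.filter fun v => lab v = a).card : ℝ) ≤ (k : ℝ) - 1

/-- The clique in which an item lies (`none` for the additional item). -/
def itemLabel {m l : ℕ} (lab : Fin m → Fin l) : Fin (m + 1) → Option (Fin l) :=
  Fin.lastCases none fun v => some (lab v)

/-- The instance in which the query and key vectors of an item are looked up in two tables `q`, `κ`
indexed by cliques, and nothing else depends on the graph. -/
def tableInstance {m d dv l : ℕ} (q κ : Option (Fin l) → Fin d → ℝ)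
    (V : Matrix (Fin (m + 1)) (Fin dv) ℝ) (u : Fin dv → ℝ) (f : Fin (m + 1) → ℝ → ℝ)
    (hf : ∀ i, Monotone (f i)) (lab : Fin m → Fin l) : Instance (m + 1) d dv where
  Q := Matrix.of fun i => q (itemLabel lab i)
  K := Matrix.of fun i => κ (itemLabel lab i)
  V := V
  u := u
  f := f
  monotone_f := hf

end SimpleTransformer

end

noncomputable section

namespace SimpleTransformer

open Finset

/-! ## Attention on one marked item -/

/-! The extra item alone carries value `1`, and every vertex gives it score `0`. So when the extra
item is selected, the output at a selected vertex is the inverse of the normalizer of its row: the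
vertex sees nothing but the sum of the exponentials of its scores. The reward thresholds this at the
capacity (`n` or `k`, by convention), the value the normalizer cannot exceed if all scores vanish. A
failing vertex costs more than all others can gain, so a positive objective means that every
selected vertex passes, and the objective is then the number of selected vertices
(`IsDetector.of_objective_pos`, `IsDetector.objective_eq_card`).

It remains to choose scores that vanish on cliques and overflow the capacity otherwise
(`capacity_lt_normalizer`). In (a) the score is `1` on distinct non-adjacent pairs. With the
restricted softmax a small non-clique may pass, but objective `k - 1` forces `|S| = k`, and then one
score `1` already overflows. In (b) the score is `R * (b - a)` for labels `a`, `b`, which needs only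
two dimensions. Negative scores occur, but a vertex of least label in `S` sees none, and any other
label contributes at least `exp R > k`. -/

/-- The scores of row `i`, masked by `S`. -/
lemma masked_score {n d : ℕ} (Q K : Matrix (Fin n) (Fin d) ℝ) {S : Finset (Fin n)} {i : Fin n}
    (hi : i ∈ S) (j : Fin n) :
    ((membership S * Q) * (membership S * K)ᵀ) i j = if j ∈ S then Q i ⬝ᵥ K j else 0 := by
  rw [Matrix.mul_apply]
  by_cases hj : j ∈ S <;>
    simp [membership, Matrix.diagonal_mul, hi, hj, dotProduct]

/-- The normalisation of row `i`, for scores `Q i ⬝ᵥ K j`. -/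
def normalizer (mode : Masking) {n d : ℕ} (Q K : Matrix (Fin n) (Fin d) ℝ) (S : Finset (Fin n))
    (i : Fin n) : ℝ :=
  ∑ j ∈ mode.columns S, Real.exp (if j ∈ S then Q i ⬝ᵥ K j else 0)

lemma Masking.subset_columns (mode : Masking) {n : ℕ} (S : Finset (Fin n)) :
    S ⊆ mode.columns S := by
  cases mode
  · exact subset_univ S
  · exact Subset.refl S

lemma normalizer_pos (mode : Masking) {n d : ℕ} (Q K : Matrix (Fin n) (Fin d) ℝ)
    {S : Finset (Fin n)} {i : Fin n} (hi : i ∈ S) : 0 < normalizer mode Q K S i :=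
  sum_pos (fun _ _ => Real.exp_pos _) ⟨i, mode.subset_columns S hi⟩

/-- An upper bound for the number of columns used by a set of at most `k` items. -/
def Masking.capacity (mode : Masking) (n k : ℕ) : ℕ :=
  match mode with
  | .zeroed => n
  | .restricted => k

/-- Vanishing scores make each column contribute exactly `1`, so the normalizer just counts columns.
-/
lemma normalizer_le_capacity (mode : Masking) {n d k : ℕ} {Q K : Matrix (Fin n) (Fin d) ℝ}
    {S : Finset (Fin n)} {i : Fin n} (hS : S.card ≤ k) (h : ∀ j ∈ S, Q i ⬝ᵥ K j = 0) :
    normalizer mode Q K S i ≤ mode.capacity n k := by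
  have hZ : normalizer mode Q K S i = (mode.columns S).card := by
    rw [normalizer, sum_congr rfl (g := fun _ => (1 : ℝ)), sum_const, nsmul_eq_mul, mul_one]
    intro j _
    split_ifs with hj
    · rw [h j hj, Real.exp_zero]
    · exact Real.exp_zero
  rw [hZ]
  cases mode
  · simp [Masking.columns, Masking.capacity]
  · exact_mod_cast hS

/-- Every column contributes at least `1`, and column `j` contributes more. In the zeroed convention
any positive score therefore exceeds `n`; `hk` serves the restricted one, where `S` may have fewer
than `k` items. -/
lemma capacity_lt_normalizer (mode : Masking) {n d k : ℕ} {Q K : Matrix (Fin n) (Fin d) ℝ}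
    {S : Finset (Fin n)} {i j : Fin n} (h : ∀ l ∈ S, 0 ≤ Q i ⬝ᵥ K l) (hj : j ∈ S)
    (hpos : 0 < Q i ⬝ᵥ K j) (hk : (k : ℝ) < S.card - 1 + Real.exp (Q i ⬝ᵥ K j)) :
    (mode.capacity n k : ℝ) < normalizer mode Q K S i := by
  have hjc := mode.subset_columns S hj
  have hle : ((mode.columns S).card : ℝ) - 1 + Real.exp (Q i ⬝ᵥ K j) ≤ normalizer mode Q K S i := by
    rw [normalizer, ← add_sum_erase _ _ hjc, if_pos hj, add_comm]
    gcongr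
    calc ((mode.columns S).card : ℝ) - 1 = ∑ _l ∈ (mode.columns S).erase j, (1 : ℝ) := by
          rw [sum_const, nsmul_eq_mul, mul_one, cast_card_erase_of_mem hjc]
      _ ≤ _ := by
          refine sum_le_sum fun l _ => Real.one_le_exp ?_
          split_ifs with hl
          · exact h l hl
          · exact le_rfl
  refine lt_of_lt_of_le ?_ hle
  cases mode
  · have := Real.one_lt_exp_iff.2 hpos
    simp only [Masking.columns, Masking.capacity, card_univ, Fintype.card_fin]
    linarith
  · exact hk

/-! ### Detectors: threshold rewards on the attention paid to the extra item -/

/-- `T` rewards a vertex with `1` if the attention it pays to the last item is at least the inverse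
of the capacity, and with a large penalty otherwise. -/
structure IsDetector (mode : Masking) (k : ℕ) {m d dv : ℕ} (T : Instance (m + 1) d dv) : Prop where
  value : ∀ i, T.V i ⬝ᵥ T.u = if i = Fin.last m then 1 else 0
  score_last : ∀ v : Fin m, T.Q v.castSucc ⬝ᵥ T.K (Fin.last m) = 0
  reward_last : ∀ x, T.f (Fin.last m) x = 0
  reward : ∀ (v : Fin m) x, T.f v.castSucc x =
    if 1 ≤ (mode.capacity (m + 1) k : ℝ) * x then 1 else -((m : ℝ) + 1)

variable {mode : Masking} {m d dv k : ℕ} {T : Instance (m + 1) d dv} {S : Finset (Fin (m + 1))}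

lemma mem_vertices {v : Fin m} : v ∈ vertices S ↔ v.castSucc ∈ S := by
  simp [vertices]

lemma card_vertices_add_one (h : Fin.last m ∈ S) : (vertices S).card + 1 = S.card := by
  have : S = (vertices S).map Fin.castSuccEmb ∪ {Fin.last m} := by
    ext i
    cases i using Fin.lastCases <;> simp [mem_vertices, h]
  rw [this, card_union_of_disjoint, card_map, card_singleton, ← this]
  simp

/-- The vertices of `C` together with the additional item. -/
def withLast (C : Finset (Fin m)) : Finset (Fin (m + 1)) :=
  insert (Fin.last m) (C.map Fin.castSuccEmb)

lemma last_mem_withLast (C : Finset (Fin m)) : Fin.last m ∈ withLast C :=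
  mem_insert_self _ _

lemma vertices_withLast (C : Finset (Fin m)) : vertices (withLast C) = C := by
  ext v
  simp [mem_vertices, withLast]

lemma card_withLast (C : Finset (Fin m)) : (withLast C).card = C.card + 1 := by
  rw [← card_vertices_add_one (last_mem_withLast C), vertices_withLast]

namespace IsDetector

/-- Only the last column has nonzero value, and its softmax numerator is `exp 0 = 1`. -/
lemma attention (hT : IsDetector mode k T) {v : Fin m} (hv : v.castSucc ∈ S) :
    selfAttention mode T.Q T.K T.V S v.castSucc ⬝ᵥ T.u =
      if Fin.last m ∈ S then (normalizer mode T.Q T.K S v.castSucc)⁻¹ else 0 := by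
  have hrow : selfAttention mode T.Q T.K T.V S v.castSucc ⬝ᵥ T.u =
      ∑ j, softmaxOn (mode.columns S) ((membership S * T.Q) * (membership S * T.K)ᵀ)
        v.castSucc j * (if j ∈ S then T.V j ⬝ᵥ T.u else 0) := by
    rw [selfAttention, dotProduct]
    simp_rw [Matrix.mul_apply (M := softmaxOn _ _), sum_mul]
    rw [sum_comm]
    refine sum_congr rfl fun j _ => ?_
    by_cases hj : j ∈ S <;>
      simp [membership, Matrix.diagonal_mul, dotProduct, hj, mul_sum, mul_assoc]
  rw [hrow, sum_eq_single (Fin.last m)]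
  · by_cases hl : Fin.last m ∈ S
    · simp only [hl, if_true, hT.value, mul_one, softmaxOn, Matrix.of_apply, masked_score _ _ hv,
        mode.subset_columns S hl, hT.score_last, Real.exp_zero, one_div]
      rfl
    · simp [hl]
  · intro j _ hj
    simp [hT.value, hj]
  · simp

lemma reward_eq (hT : IsDetector mode k T) {v : Fin m} (hv : v.castSucc ∈ S) :
    T.f v.castSucc (selfAttention mode T.Q T.K T.V S v.castSucc ⬝ᵥ T.u) =
      if Fin.last m ∈ S ∧ normalizer mode T.Q T.K S v.castSucc ≤ mode.capacity (m + 1) k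
      then 1 else -((m : ℝ) + 1) := by
  rw [hT.reward, hT.attention hv]
  by_cases hl : Fin.last m ∈ S
  · simp only [hl, if_true, true_and, ← div_eq_mul_inv,
      one_le_div (normalizer_pos mode T.Q T.K hv)]
  · simp [hl]

lemma objective_eq (hT : IsDetector mode k T) : T.objective mode S = ∑ v ∈ vertices S,
    if Fin.last m ∈ S ∧ normalizer mode T.Q T.K S v.castSucc ≤ mode.capacity (m + 1) k
      then 1 else -((m : ℝ) + 1) := by
  rw [Instance.objective, ← univ_inter S, ← sum_ite_mem, Fin.sum_univ_castSucc, hT.reward_last,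
    ite_self, add_zero, vertices, sum_filter]
  refine sum_congr rfl fun v _ => ?_
  rw [univ_inter]
  by_cases hv : v.castSucc ∈ S
  · rw [if_pos hv, if_pos hv, hT.reward_eq hv]
  · rw [if_neg hv, if_neg hv]

lemma objective_eq_card (hT : IsDetector mode k T) (hl : Fin.last m ∈ S)
    (h : ∀ v ∈ vertices S,
      normalizer mode T.Q T.K S v.castSucc ≤ mode.capacity (m + 1) k) :
    T.objective mode S = (vertices S).card := by
  rw [hT.objective_eq, sum_congr rfl fun v hv => if_pos ⟨hl, h v hv⟩]
  simp

/-- A positive objective value is attained only if no vertex is penalised. -/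
lemma of_objective_pos (hT : IsDetector mode k T) (h : 0 < T.objective mode S) :
    Fin.last m ∈ S ∧ ∀ v ∈ vertices S,
      normalizer mode T.Q T.K S v.castSucc ≤ mode.capacity (m + 1) k := by
  have key : ∀ v ∈ vertices S, Fin.last m ∈ S ∧
      normalizer mode T.Q T.K S v.castSucc ≤ mode.capacity (m + 1) k := by
    intro v hv
    by_contra hcon
    rw [hT.objective_eq, ← add_sum_erase _ _ hv, if_neg hcon] at h
    -- The other vertices earn at most `m` in total, which cannot offset a penalty of `m + 1`.
    have h1 := sum_le_card_nsmul ((vertices S).erase v)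
      (fun v => if Fin.last m ∈ S ∧
        normalizer mode T.Q T.K S v.castSucc ≤ mode.capacity (m + 1) k
        then (1 : ℝ) else -((m : ℝ) + 1)) 1 fun v _ => by
          split_ifs
          · exact le_rfl
          · linarith [(Nat.cast_nonneg m : (0 : ℝ) ≤ m)]
    have h2 : ((((vertices S).erase v).card : ℕ) : ℝ) ≤ m := by
      exact_mod_cast (card_le_univ _).trans_eq (Fintype.card_fin m)
    rw [nsmul_eq_mul, mul_one] at h1
    linarith
  refine ⟨?_, fun v hv => (key v hv).2⟩
  -- Without vertices `key` is vacuous, but then the objective is `0`.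
  rcases (vertices S).eq_empty_or_nonempty with he | ⟨v, hv⟩
  · rw [hT.objective_eq, he, sum_empty] at h
    exact absurd h (lt_irrefl _)
  · exact (key v hv).1

/-- A set of at most `k - 1` vertices with vanishing scores is worth its cardinality. -/
lemma objective_withLast (hT : IsDetector mode k T) {C : Finset (Fin m)} (hC : C.card + 1 ≤ k)
    (h : ∀ v ∈ C, ∀ w ∈ C, T.Q v.castSucc ⬝ᵥ T.K w.castSucc = 0) :
    T.objective mode (withLast C) = C.card := by
  rw [hT.objective_eq_card (last_mem_withLast C), vertices_withLast]
  intro v hv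
  rw [vertices_withLast] at hv
  refine normalizer_le_capacity mode ((card_withLast C).trans_le hC) fun j hj => ?_
  cases j using Fin.lastCases with
  | last => exact hT.score_last v
  | cast w => exact h v hv w (by rwa [← mem_vertices, vertices_withLast] at hj)

end IsDetector

/-! ### Concrete values and rewards of a detector -/

lemma monotone_step {T p q : ℝ} (hT : 0 ≤ T) (h : p ≤ q) :
    Monotone fun x : ℝ => if 1 ≤ T * x then q else p := by
  intro x y hxy
  have := mul_le_mul_of_nonneg_left hxy hT
  dsimp only
  split_ifs with h1 h2
  · exact le_rfl
  · exact absurd (h1.trans this) h2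
  · exact h
  · exact le_rfl

/-- The reward functions of a detector. -/
def detectorReward (mode : Masking) (m k : ℕ) (i : Fin (m + 1)) (x : ℝ) : ℝ :=
  if 1 ≤ (mode.capacity (m + 1) k : ℝ) * x then if i = Fin.last m then 0 else 1
  else if i = Fin.last m then 0 else -((m : ℝ) + 1)

lemma monotone_detectorReward (mode : Masking) (m k : ℕ) (i : Fin (m + 1)) :
    Monotone (detectorReward mode m k i) := by
  refine monotone_step (Nat.cast_nonneg _) ?_
  split_ifs
  · exact le_rfl
  · linarith [(Nat.cast_nonneg m : (0 : ℝ) ≤ m)]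

/-- The value vectors of a detector. -/
def detectorValue (m : ℕ) : Matrix (Fin (m + 1)) (Fin 1) ℝ :=
  Matrix.of fun i _ => if i = Fin.last m then 1 else 0

lemma isDetector_of {Q K : Matrix (Fin (m + 1)) (Fin d) ℝ}
    (h : ∀ v : Fin m, Q v.castSucc ⬝ᵥ K (Fin.last m) = 0) :
    IsDetector mode k ⟨Q, K, detectorValue m, fun _ => 1, detectorReward mode m k,
      monotone_detectorReward mode m k⟩ where
  value i := by simp [detectorValue, dotProduct]
  score_last := h
  reward_last x := by simp [detectorReward]
  reward v x := by simp [detectorReward, Fin.castSucc_ne_last]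

/-! ## Cliques of prescribed size -/

/-- The queries of the clique instance: `1` at every pair of distinct non-adjacent vertices. -/
def cliqueQuery (G : SimpleGraph (Fin m)) : Matrix (Fin (m + 1)) (Fin (m + 1)) ℝ :=
  Matrix.of fun i j => if j = Fin.last m then 0 else if i = j then 0 else 1 - adjBit G i j

/-- The clique instance; its keys form the identity matrix. -/
def cliqueInstance (mode : Masking) (k : ℕ) (G : SimpleGraph (Fin m)) :
    Instance (m + 1) (m + 1) 1 :=
  ⟨cliqueQuery G, 1, detectorValue m, fun _ => 1, detectorReward mode m k,
    monotone_detectorReward mode m k⟩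

lemma cliqueInstance_score (G : SimpleGraph (Fin m)) (i j : Fin (m + 1)) :
    (cliqueInstance mode k G).Q i ⬝ᵥ (cliqueInstance mode k G).K j = cliqueQuery G i j := by
  simp [cliqueInstance, dotProduct, Matrix.one_apply]

lemma isDetector_cliqueInstance (G : SimpleGraph (Fin m)) :
    IsDetector mode k (cliqueInstance mode k G) :=
  isDetector_of fun v =>
    (cliqueInstance_score (mode := mode) (k := k) G _ _).trans (by simp [cliqueQuery])

open Classical in
lemma cliqueQuery_castSucc (G : SimpleGraph (Fin m)) (v w : Fin m) :
    cliqueQuery G v.castSucc w.castSucc = if v = w ∨ G.Adj v w then 0 else 1 := by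
  by_cases h : v = w
  · simp [cliqueQuery, h]
  · by_cases h' : G.Adj v w <;> simp [cliqueQuery, adjBit, Fin.castSucc_ne_last, h, h']

lemma objective_withLast_of_isClique {G : SimpleGraph (Fin m)} {C : Finset (Fin m)}
    (hC : G.IsClique (C : Set (Fin m))) (hk : C.card + 1 ≤ k) :
    (cliqueInstance mode k G).objective mode (withLast C) = C.card := by
  refine (isDetector_cliqueInstance G).objective_withLast hk fun v hv w hw => ?_
  rw [cliqueInstance_score, cliqueQuery_castSucc, if_pos]
  by_cases h : v = w
  · exact Or.inl h
  · exact Or.inr (hC hv hw h)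

/-- An objective value of at least `k - 1` is attained only at cliques. -/
lemma isNClique_of_le_objective {G : SimpleGraph (Fin m)} (hk : 2 ≤ k) (hS : S.card ≤ k)
    (h : (k : ℝ) - 1 ≤ (cliqueInstance mode k G).objective mode S) :
    (cliqueInstance mode k G).objective mode S = (k : ℝ) - 1 ∧
      G.IsNClique (k - 1) (vertices S) := by
  have hk' : (2 : ℝ) ≤ k := by exact_mod_cast hk
  obtain ⟨hl, hv⟩ := (isDetector_cliqueInstance G).of_objective_pos (by linarith)
  have hobj := (isDetector_cliqueInstance G).objective_eq_card hl hv
  have hcard := card_vertices_add_one hl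
  have hkS : S.card = k := by
    -- The objective counts vertices, so at least `k - 1` of them and the extra item fill the
    -- budget.
    refine le_antisymm hS ?_
    rw [hobj] at h
    have : (k : ℝ) ≤ ((vertices S).card + 1 : ℕ) := by push_cast; linarith
    exact (Nat.cast_le.1 this).trans_eq hcard
  refine ⟨?_, ?_, by omega⟩
  · rw [hobj, ← hkS, ← hcard]
    push_cast
    ring
  · intro v hvS w hwS hne
    by_contra hadj
    refine absurd (hv v hvS) (not_le.2 ?_)
    have hone : (cliqueInstance mode k G).Q v.castSucc ⬝ᵥ
        (cliqueInstance mode k G).K w.castSucc = 1 := by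
      rw [cliqueInstance_score, cliqueQuery_castSucc, if_neg (by tauto)]
    refine capacity_lt_normalizer mode (fun l _ => ?_) (mem_vertices.1 hwS) ?_ ?_
    · rw [cliqueInstance_score]
      cases l using Fin.lastCases with
      | last => simp [cliqueQuery]
      | cast u =>
        rw [cliqueQuery_castSucc]
        split_ifs <;> norm_num
    · rw [hone]; exact one_pos
    · rw [hone, hkS]
      linarith [Real.one_lt_exp_iff.2 one_pos]

lemma solvesClique_cliqueInstance (G : SimpleGraph (Fin m)) (hk : 2 ≤ k) :
    SolvesClique mode (cliqueInstance mode k G) k G := by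
  intro S hS
  refine ⟨fun ⟨C, hC⟩ => isNClique_of_le_objective hk hS.1 ?_, fun hno => ?_⟩
  · have hcard : C.card + 1 = k := by have := hC.card_eq; omega
    refine le_trans (le_of_eq ?_) (hS.2 (withLast C) ((card_withLast C).trans_le hcard.le))
    rw [objective_withLast_of_isClique hC.isClique hcard.le, ← hcard]
    push_cast
    ring
  · by_contra hlt
    exact hno ⟨_, (isNClique_of_le_objective hk hS.1 (not_lt.1 hlt)).2⟩

lemma optPos_cliqueInstance (G : SimpleGraph (Fin m)) (hm : 1 ≤ m) (hk : 2 ≤ k) :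
    (cliqueInstance mode k G).OptPos mode k := by
  refine ⟨withLast {⟨0, hm⟩}, by simpa [card_withLast] using hk, ?_⟩
  rw [objective_withLast_of_isClique (by simp) (by simpa using hk)]
  simp

/-! ### Writing the clique instance with fixed formulas -/

/-- The formula for the capacity. -/
def Masking.capacityVar : Masking → Var
  | .zeroed => .n
  | .restricted => .k

/-- The program that writes down the clique instance. -/
def cliqueProgram (mode : Masking) : Program where
  Q := .ifLe (.var .n) (.var .j) (.const 0)
    (.ifLe (.mul (.add (.var .i) (.mul (.const (-1)) (.var .j)))
        (.add (.var .i) (.mul (.const (-1)) (.var .j)))) (.const 0) (.const 0)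
      (.add (.const 1) (.mul (.const (-1)) (.var .bit))))
  K := .ifLe (.mul (.add (.var .i) (.mul (.const (-1)) (.var .j)))
        (.add (.var .i) (.mul (.const (-1)) (.var .j)))) (.const 0) (.const 1) (.const 0)
  V := .ifLe (.var .n) (.var .i) (.const 1) (.const 0)
  u := .const 1
  f := .ifLe (.const 1) (.mul (.var mode.capacityVar) (.var .x))
    (.ifLe (.var .n) (.var .i) (.const 0) (.const 1))
    (.ifLe (.var .n) (.var .i) (.const 0) (.mul (.const (-1)) (.var .n)))

lemma add_one_le_index_iff (i : Fin (m + 1)) :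
    (m : ℝ) + 1 ≤ (i : ℕ) + 1 ↔ i = Fin.last m := by
  rw [add_le_add_iff_right, Nat.cast_le, Fin.ext_iff, Fin.val_last]
  exact ⟨fun h => le_antisymm (Nat.lt_succ_iff.1 i.2) h, fun h => h.ge⟩

/-- Formulas can only test `≤`; a square being nonpositive encodes equality of indices. -/
lemma sq_index_sub_nonpos_iff {n : ℕ} (i j : Fin n) :
    (((i : ℕ) : ℝ) + 1 + -1 * ((j : ℕ) + 1)) * ((i : ℕ) + 1 + -1 * ((j : ℕ) + 1)) ≤ 0 ↔ i = j := by
  constructor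
  · intro h
    have := mul_self_eq_zero.1 (le_antisymm h (mul_self_nonneg _))
    have h' : ((i : ℕ) : ℝ) = (j : ℕ) := by linarith
    exact Fin.ext (Nat.cast_injective h')
  · rintro rfl
    simp

lemma outputs_cliqueInstance (G : SimpleGraph (Fin m)) :
    (cliqueProgram mode).Outputs k G (cliqueInstance mode k G) where
  Q i j := by
    simp only [cliqueProgram, Formula.eval, env, Rat.cast_zero, Rat.cast_one, Rat.cast_neg,
      add_one_le_index_iff, sq_index_sub_nonpos_iff]
    simp only [cliqueInstance, cliqueQuery, Matrix.of_apply, neg_one_mul, ← sub_eq_add_neg]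
  K i j := by
    simp only [cliqueProgram, Formula.eval, env, Rat.cast_zero, Rat.cast_one, Rat.cast_neg,
      sq_index_sub_nonpos_iff]
    simp only [cliqueInstance, Matrix.one_apply]
  V i j := by
    simp only [cliqueProgram, Formula.eval, env, Rat.cast_zero, Rat.cast_one, add_one_le_index_iff]
    simp only [cliqueInstance, detectorValue, Matrix.of_apply]
  u j := by simp [cliqueProgram, Formula.eval, cliqueInstance]
  f i x := by
    have hcap : env ((m : ℝ) + 1) k ((i : ℕ) + 1) 0 0 x mode.capacityVar =
        (mode.capacity (m + 1) k : ℝ) := by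
      cases mode <;> simp [Masking.capacityVar, Masking.capacity, env]
    simp only [cliqueProgram, Formula.eval, hcap]
    simp only [env, Rat.cast_zero, Rat.cast_one, Rat.cast_neg, add_one_le_index_iff]
    simp only [cliqueInstance, detectorReward, neg_one_mul]

/-! ## Disjoint cliques -/

/-- In two dimensions there are queries and keys whose scores are the differences of the labels. -/
lemma exists_tables (d l : ℕ) (hdl : 2 ≤ d ∨ l ≤ 1) (R : ℝ) :
    ∃ q κ : Option (Fin l) → Fin d → ℝ, κ none = 0 ∧
      ∀ a b : Fin l, q (some a) ⬝ᵥ κ (some b) = R * ((b : ℕ) - (a : ℕ)) := by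
  rcases hdl with hd | hl
  · obtain ⟨d, rfl⟩ := Nat.exists_eq_add_of_le' hd
    -- The query `(-R a, R, 0, …)` and the key `(1, b, 0, …)` have inner product `R (b - a)`.
    refine ⟨fun o => o.elim 0 fun a => Fin.cons (-(R * (a : ℕ))) (Fin.cons R 0),
      fun o => o.elim 0 fun b => Fin.cons 1 (Fin.cons ((b : ℕ) : ℝ) 0), rfl, fun a b => ?_⟩
    simp only [Option.elim, dotProduct, Fin.sum_univ_succ, Fin.cons_zero, Fin.cons_succ,
      Pi.zero_apply, mul_zero, sum_const_zero]
    ring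
  -- With at most one label every required score is `0`, so zero tables work in any dimension.
  · have : Subsingleton (Fin l) := Fin.subsingleton_iff_le_one.2 hl
    refine ⟨0, 0, rfl, fun a b => ?_⟩
    rw [Subsingleton.elim a b]
    simp

variable {l : ℕ} {lab : Fin m → Fin l} {G : SimpleGraph (Fin m)}
  {q κ : Option (Fin l) → Fin d → ℝ}

lemma itemLabel_castSucc (lab : Fin m → Fin l) (v : Fin m) :
    itemLabel lab v.castSucc = some (lab v) :=
  Fin.lastCases_castSucc _

lemma itemLabel_last (lab : Fin m → Fin l) : itemLabel lab (Fin.last m) = none :=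
  Fin.lastCases_last

/-- The instance in which the queries and keys are looked up in `q` and `κ`. -/
abbrev labelInstance (mode : Masking) (k : ℕ) (q κ : Option (Fin l) → Fin d → ℝ)
    (lab : Fin m → Fin l) : Instance (m + 1) d 1 :=
  tableInstance q κ (detectorValue m) (fun _ => 1) (detectorReward mode m k)
    (monotone_detectorReward mode m k) lab

lemma isDetector_labelInstance (hκ : κ none = 0) :
    IsDetector mode k (labelInstance mode k q κ lab) :=
  isDetector_of fun v => by
    change q _ ⬝ᵥ κ (itemLabel lab (Fin.last m)) = 0
    rw [itemLabel_last, hκ, dotProduct_zero]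

variable {R : ℝ}

lemma labelInstance_score
    (hs : ∀ a b : Fin l, q (some a) ⬝ᵥ κ (some b) = R * ((b : ℕ) - (a : ℕ))) (v w : Fin m) :
    (labelInstance mode k q κ lab).Q v.castSucc ⬝ᵥ (labelInstance mode k q κ lab).K w.castSucc =
      R * ((lab w : ℕ) - (lab v : ℕ)) := by
  rw [← hs, ← itemLabel_castSucc, ← itemLabel_castSucc]
  rfl

lemma IsDisjointCliques.isClique_iff {M : ℝ} (hG : IsDisjointCliques G lab k M)
    {C : Finset (Fin m)} :
    G.IsClique (C : Set (Fin m)) ↔ ∀ v ∈ C, ∀ w ∈ C, lab v = lab w := by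
  constructor
  · intro h v hv w hw
    by_cases hvw : v = w
    · rw [hvw]
    · exact ((hG.adj_iff v w).1 (h hv hw hvw)).2
  · exact fun h v hv w hw hvw => (hG.adj_iff v w).2 ⟨hvw, h v hv w hw⟩

lemma IsDisjointCliques.card_add_one_le {M : ℝ} (hG : IsDisjointCliques G lab k M)
    {C : Finset (Fin m)} (hC : G.IsClique (C : Set (Fin m))) (hk : 1 ≤ k) : C.card + 1 ≤ k := by
  rcases C.eq_empty_or_nonempty with rfl | ⟨v, hv⟩
  · simpa using hk
  · have h1 : C.card ≤ (univ.filter fun w => lab w = lab v).card :=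
      card_le_card fun w hw => mem_filter.2 ⟨mem_univ w, hG.isClique_iff.1 hC w hw v hv⟩
    have h2 := hG.card_le (lab v)
    have h3 : (C.card : ℝ) ≤ ((univ.filter fun w => lab w = lab v).card : ℝ) := by
      exact_mod_cast h1
    have h4 : ((C.card + 1 : ℕ) : ℝ) ≤ k := by push_cast; linarith
    exact_mod_cast h4

lemma objective_labelInstance_withLast {M : ℝ} (hG : IsDisjointCliques G lab k M) (hk : 1 ≤ k)
    (hκ : κ none = 0)
    (hs : ∀ a b : Fin l, q (some a) ⬝ᵥ κ (some b) = R * ((b : ℕ) - (a : ℕ)))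
    {C : Finset (Fin m)} (hC : G.IsClique (C : Set (Fin m))) :
    (labelInstance mode k q κ lab).objective mode (withLast C) = C.card := by
  refine (isDetector_labelInstance hκ).objective_withLast (hG.card_add_one_le hC hk)
    fun v hv w hw => ?_
  rw [labelInstance_score hs, hG.isClique_iff.1 hC v hv w hw, sub_self, mul_zero]

/-- Only cliques have a positive objective value: the vertices of least label in a set with several
labels are penalised. -/
lemma isClique_of_objective_pos {M : ℝ} (hG : IsDisjointCliques G lab k M)
    (hR : 0 < R) (hkR : (k : ℝ) < Real.exp R) (hκ : κ none = 0)
    (hs : ∀ a b : Fin l, q (some a) ⬝ᵥ κ (some b) = R * ((b : ℕ) - (a : ℕ)))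
    (h : 0 < (labelInstance mode k q κ lab).objective mode S) :
    G.IsClique (vertices S : Set (Fin m)) ∧
      (labelInstance mode k q κ lab).objective mode S = (vertices S).card := by
  have hT : IsDetector mode k (labelInstance mode k q κ lab) := isDetector_labelInstance hκ
  obtain ⟨hl, hv⟩ := hT.of_objective_pos h
  refine ⟨?_, hT.objective_eq_card hl hv⟩
  rcases (vertices S).eq_empty_or_nonempty with he | hne
  · simp [he]
  -- From a vertex of least label all scores are nonnegative, so no negative score can compensate
  -- the large one.
  obtain ⟨v, hvS, hmin⟩ := exists_min_image (vertices S) lab hne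
  have hlab : ∀ w ∈ vertices S, lab w = lab v := by
    intro w hwS
    by_contra hne
    have hlt : lab v < lab w := lt_of_le_of_ne (hmin w hwS) (Ne.symm hne)
    have hgap : R ≤ R * (((lab w : ℕ) : ℝ) - (lab v : ℕ)) := by
      have : ((lab v : ℕ) : ℝ) + 1 ≤ (lab w : ℕ) := by exact_mod_cast hlt
      exact le_mul_of_one_le_right hR.le (by linarith)
    refine absurd (hv v hvS) (not_le.2 ?_)
    refine capacity_lt_normalizer mode (fun j hj => ?_) (mem_vertices.1 hwS) ?_ ?_
    · cases j using Fin.lastCases with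
      | last => exact (hT.score_last v).ge
      | cast u =>
        rw [labelInstance_score hs]
        have : ((lab v : ℕ) : ℝ) ≤ (lab u : ℕ) := by exact_mod_cast hmin u (mem_vertices.2 hj)
        exact mul_nonneg hR.le (by linarith)
    · rw [labelInstance_score hs]
      exact hR.trans_le hgap
    · rw [labelInstance_score hs]
      -- Since `exp R` alone exceeds `k`, it is enough that `S` is nonempty; its size need not be
      -- `k`.
      have h1 : (1 : ℝ) ≤ S.card := by exact_mod_cast card_pos.2 ⟨_, hl⟩
      have h2 := Real.exp_le_exp.2 hgap
      linarith
  exact hG.isClique_iff.2 fun a ha b hb => (hlab a ha).trans (hlab b hb).symm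

/-- Every clique fits the budget together with the extra item and attains its size, while an optimal
set has positive objective and hence is a clique; optimality compares the sizes. -/
lemma labelInstance_solves {M : ℝ} (hG : IsDisjointCliques G lab k M) (hm : 1 ≤ m) (hk : 2 ≤ k)
    (hR : 0 < R) (hkR : (k : ℝ) < Real.exp R) (hκ : κ none = 0)
    (hs : ∀ a b : Fin l, q (some a) ⬝ᵥ κ (some b) = R * ((b : ℕ) - (a : ℕ))) :
    (labelInstance mode k q κ lab).OptPos mode k ∧
      SolvesMaxClique mode (labelInstance mode k q κ lab) k G := by
  have hk1 : 1 ≤ k := one_le_two.trans hk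
  have hval := fun {C : Finset (Fin m)} (hC : G.IsClique (C : Set (Fin m))) =>
    objective_labelInstance_withLast (mode := mode) hG hk1 hκ hs hC
  obtain ⟨S₀, hS₀, hpos⟩ : (labelInstance mode k q κ lab).OptPos mode k := by
    refine ⟨withLast {⟨0, hm⟩}, by simpa [card_withLast] using hk, ?_⟩
    rw [hval (by simp)]
    simp
  refine ⟨⟨S₀, hS₀, hpos⟩, fun S hS => ?_⟩
  obtain ⟨hcl, hobj⟩ :=
    isClique_of_objective_pos hG hR hkR hκ hs (hpos.trans_le (hS.2 S₀ hS₀))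
  refine ⟨fun C hC => ?_, hcl, hobj⟩
  have := hS.2 (withLast C) ((card_withLast C).trans_le (hG.card_add_one_le hC hk1))
  rw [hval hC, hobj] at this
  exact_mod_cast this

/-- For `c = 1 / 2` there is at most one label in dimension less than two. -/
lemma two_le_or_le_one_of_le_exp {d l : ℕ} (h : (l : ℝ) ≤ Real.exp (1 / 2 * d)) :
    2 ≤ d ∨ l ≤ 1 := by
  by_contra! hcon
  obtain ⟨hd, hl⟩ := hcon
  have hd' : (d : ℝ) ≤ 1 := by exact_mod_cast Nat.lt_succ_iff.1 hd
  have hl' : (2 : ℝ) ≤ l := by exact_mod_cast hl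
  -- Two labels in dimension at most one would give `exp (1 / 2) ≥ 2`, hence `e ≥ 4`.
  have h2 : (2 : ℝ) ≤ Real.exp (1 / 2) :=
    hl'.trans (h.trans (Real.exp_le_exp.2 (by linarith)))
  have h3 : Real.exp (1 / 2) * Real.exp (1 / 2) = Real.exp 1 := by
    rw [← Real.exp_add]
    norm_num
  nlinarith [Real.exp_one_lt_d9]

end SimpleTransformer

end

theorem mainTheorem5 (mode : SimpleTransformer.Masking) :
    (∃ (dv : ℕ) (P : SimpleTransformer.Program), ∀ (m k : ℕ), 1 ≤ m → 4 ≤ k →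
      ∀ G : SimpleGraph (Fin m),
        ∃ T : SimpleTransformer.Instance (m + 1) (m + 1) dv,
          P.Outputs k G T ∧ T.OptPos mode k ∧ SimpleTransformer.SolvesClique mode T k G) ∧
    (∀ M : ℝ, 3 ≤ M → ∃ c : ℝ, 0 < c ∧ ∀ m d k l : ℕ,
      Real.exp (c * d) ≤ m → M + 1 ≤ k → (l : ℝ) ≤ Real.exp (c * d) →
        ∃ (dv : ℕ) (q κ : Option (Fin l) → Fin d → ℝ)
          (V : Matrix (Fin (m + 1)) (Fin dv) ℝ) (u : Fin dv → ℝ) (f : Fin (m + 1) → ℝ → ℝ)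
          (hf : ∀ i, Monotone (f i)),
          ∀ (G : SimpleGraph (Fin m)) (lab : Fin m → Fin l),
            SimpleTransformer.IsDisjointCliques G lab k M →
              (SimpleTransformer.tableInstance q κ V u f hf lab).OptPos mode k ∧
              SimpleTransformer.SolvesMaxClique mode
                (SimpleTransformer.tableInstance q κ V u f hf lab) k G) := by
  refine ⟨⟨1, SimpleTransformer.cliqueProgram mode, fun m k hm hk G =>
    ⟨SimpleTransformer.cliqueInstance mode k G, SimpleTransformer.outputs_cliqueInstance G,
      SimpleTransformer.optPos_cliqueInstance G hm (by omega),
      SimpleTransformer.solvesClique_cliqueInstance G (by omega)⟩⟩,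
    fun M hM => ⟨1 / 2, by norm_num, fun m d k l hm hk hl => ?_⟩⟩
  -- The scale is `R = k`, since `exp k ≥ k + 1 > k`.
  obtain ⟨q, κ, hκ, hs⟩ := SimpleTransformer.exists_tables d l
    (SimpleTransformer.two_le_or_le_one_of_le_exp hl) k
  have hm' : (0 : ℝ) < m := (Real.exp_pos _).trans_le hm
  have hk' : (2 : ℝ) ≤ k := by linarith
  exact ⟨1, q, κ, SimpleTransformer.detectorValue m, fun _ => 1,
    SimpleTransformer.detectorReward mode m k,
    SimpleTransformer.monotone_detectorReward mode m k, fun G lab hG =>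
      SimpleTransformer.labelInstance_solves hG (Nat.cast_pos.1 hm') (by exact_mod_cast hk')
        (by linarith) (by linarith [Real.add_one_le_exp (k : ℝ)]) hκ hs⟩
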